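/- Let $\mathbb K=\mathbb R$ or $\mathbb C$, and let $\mathbb N=\{1,2,3,\dots\}$. A set $A\subseteq\mathbb N\cup\{0\}$ is *Sidon* if all the sums $a+b$ with $a,b\in A$, $a\le b$, are different. An *operator* on a Banach space $X$ over $\mathbb K$ is a continuous linear map $T:X\to X$; it is *hypercyclic* if there is $x\in X$ whose orbit $\{T^n x: n\ge 0\}$ is dense in $X$, and *weakly mixing* if $T\oplus T$ is hypercyclic on $X\oplus X$. A family $(T_i)_{i\in I}$ of operators on $X$ is *disjoint hypercyclic* if there is $x\in X$ such that for every family $(U_i)_{i\in I}$ of nonempty open subsets of $X$ there is $n\geq 0$ with $T_i^n x\in U_i$ for every $i\in I$. Below, $\ell_1$ is the space of absolutely summable sequences in $\mathbb K$. **Theorem.** 1. Let $J\subseteq\mathbb N$ be a finite set. Then $J\cup\{0\}$ is Sidon if and only if there exists a non weakly mixing operator $T:\ell_1\to\ell_1$ such that $\{T^j:j\in J\}$ is disjoint hypercyclic. 2. Let $X$ be a Banach space, let $J\subseteq\mathbb N$ be such that $J\cup\{0\}$ is not Sidon, and let $T:X\to X$ be an operator such that $\{T^j:j\in J\}$ is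 disjoint hypercyclic. Then $T$ is weakly mixing. 3. There exists a non weakly mixing operator $T:\ell_1\to\ell_1$ such that $\{T^j:j\in J\}$ is disjoint hypercyclic for every finite set $J\subseteq\mathbb N$ such that $J\cup\{0\}$ is Sidon. -/

import Mathlib

/-- A set `A` of natural numbers is Sidon if all the sums `a + b` with `a, b ∈ A`, `a ≤ b`,
are different. -/
def IsSidon (A : Set ℕ) : Prop :=
  ∀ a ∈ A, ∀ b ∈ A, ∀ c ∈ A, ∀ d ∈ A, a ≤ b → c ≤ d → a + b = c + d → a = c ∧ b = d

/-- A continuous linear operator `T` is hypercyclic if some vector has a dense `T`-orbit. -/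
def IsHypercyclic {𝕜 X : Type*} [RCLike 𝕜] [NormedAddCommGroup X] [NormedSpace 𝕜 X]
    (T : X →L[𝕜] X) : Prop :=
  ∃ x : X, Dense (Set.range fun n : ℕ => (T ^ n) x)

/-- `T` is weakly mixing if `T ⊕ T` is hypercyclic on `X ⊕ X`. -/
def IsWeaklyMixing {𝕜 X : Type*} [RCLike 𝕜] [NormedAddCommGroup X] [NormedSpace 𝕜 X]
    (T : X →L[𝕜] X) : Prop :=
  IsHypercyclic (T.prodMap T)

/-- A family `(T i)` of operators on `X` is disjoint hypercyclic if there is one vector `x` such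
that for all nonempty open sets `U i` there is an `n` with `(T i) ^ n x ∈ U i` for every `i`. -/
def IsDisjointHypercyclic {𝕜 X ι : Type*} [RCLike 𝕜] [NormedAddCommGroup X] [NormedSpace 𝕜 X]
    (T : ι → (X →L[𝕜] X)) : Prop :=
  ∃ x : X, ∀ U : ι → Set X, (∀ i, IsOpen (U i)) → (∀ i, (U i).Nonempty) →
    ∃ n : ℕ, ∀ i, (T i ^ n) x ∈ U i

/-- The sequence space `ℓ₁` over `𝕜`. -/
abbrev EllOne (𝕜 : Type*) [RCLike 𝕜] : Type _ := lp (fun _ : ℕ => 𝕜) 1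

/-! If `J ∪ {0}` is not Sidon, it contains a coincidence `a + b = c + d` with `c`, `d` strictly
between `a` and `b`. A disjoint hypercyclic vector yields `n` and `w` with `T^(an) w ∈ U`, `T^(cn)
w, T^(dn) w ∈ V`, `T^(bn) w ∈ W`. As `c - a = b - d`, one power of `T` moves a point of `U` into `V`
and a point of `V` into `W`, which forces weak mixing (`IsWeaklyMixing.of_three_open_sets`).

Conversely, `T` is multiplication by `X` on the completion of `𝕜[X]` for the `ℓ₁`-norm of a basis
`e` with `deg (e k) = k`. It is not weakly mixing once some functional `φ ≠ 0` makes `(P, Q) ↦ φ (P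
* Q)` bounded (`exists_operator_of_basis`). The vector `1` is disjoint hypercyclic if, for enough
targets `P j` and arbitrarily large `a`, some `N` satisfies `e (j * N) = a (X ^ (j * N) - P j)` for
all `j ∈ J`, since basis vectors have norm one.

The basis and the moments of `φ` are built in stages, each solving one of countably many such tasks
(`IsStage.exists_next`). To keep the form bounded although `a` is large, `φ` treats `X ^ (j * N)` as
`P j` and `X ^ ((i + j) * N)` as `P i * P j`. The Sidon property makes these prescriptions
consistent (`exists_product_function_of_isSidon`). -/

open Polynomial

/-! ### Non-Sidon exponents force weak mixing. -/

section WeakMixing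

variable {𝕜 X : Type*} [RCLike 𝕜] [NormedAddCommGroup X] [NormedSpace 𝕜 X]

/-- The Birkhoff transitivity theorem. -/
theorem IsHypercyclic.of_transitive [SecondCountableTopology X] [CompleteSpace X]
    {T : X →L[𝕜] X}
    (h : ∀ U V : Set X, IsOpen U → IsOpen V → U.Nonempty → V.Nonempty →
      ∃ n : ℕ, ∃ u ∈ U, (T ^ n) u ∈ V) : IsHypercyclic T := by
  set B := TopologicalSpace.countableBasis X with hB
  have hBb := TopologicalSpace.isBasis_countableBasis X
  have hcount : B.Countable := TopologicalSpace.countable_countableBasis X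
  have hdense : Dense (⋂ V ∈ B, ⋃ n : ℕ, (T ^ n) ⁻¹' V) := by
    refine dense_biInter_of_isOpen (fun V hV => ?_) hcount (fun V hV => ?_)
    · exact isOpen_iUnion fun n => (hBb.isOpen hV).preimage (T ^ n).continuous
    · rw [dense_iff_inter_open]
      intro U hU hUne
      obtain ⟨n, u, hu, huV⟩ := h U V hU (hBb.isOpen hV) hUne
        (TopologicalSpace.nonempty_of_mem_countableBasis hV)
      exact ⟨u, hu, Set.mem_iUnion.2 ⟨n, huV⟩⟩
  obtain ⟨x, hx⟩ := hdense.nonempty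
  refine ⟨x, hBb.dense_iff.2 fun V hV hVne => ?_⟩
  obtain ⟨n, hn⟩ := Set.mem_iUnion.1 (Set.mem_iInter₂.1 hx V hV)
  exact ⟨_, hn, n, rfl⟩

theorem ContinuousLinearMap.prodMap_pow_apply (T : X →L[𝕜] X) (n : ℕ) (p : X × X) :
    (T.prodMap T ^ n) p = ((T ^ n) p.1, (T ^ n) p.2) := by
  induction n with
  | zero => rfl
  | succ n ih => simp only [pow_succ', mul_apply_eq_comp, ih]; rfl

theorem ContinuousLinearMap.pow_add_apply (T : X →L[𝕜] X) (m n : ℕ) (x : X) :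
    (T ^ (m + n)) x = (T ^ m) ((T ^ n) x) := by
  rw [pow_add, mul_apply_eq_comp]

/-- If for all nonempty open sets `U`, `V`, `W` some power of `T` sends a point of `U` into `V`
and a point of `V` into `W`, then `T` is weakly mixing. -/
theorem IsWeaklyMixing.of_three_open_sets [SecondCountableTopology X] [CompleteSpace X]
    {T : X →L[𝕜] X}
    (h : ∀ U V W : Set X, IsOpen U → IsOpen V → IsOpen W → U.Nonempty → V.Nonempty → W.Nonempty →
      ∃ n : ℕ, (∃ u ∈ U, (T ^ n) u ∈ V) ∧ ∃ v ∈ V, (T ^ n) v ∈ W) : IsWeaklyMixing T := by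
  refine IsHypercyclic.of_transitive fun U V hU hV hUne hVne => ?_
  obtain ⟨⟨x₁, x₂⟩, hx⟩ := hUne
  obtain ⟨⟨y₁, y₂⟩, hy⟩ := hVne
  obtain ⟨ε, hε, hUε⟩ := Metric.isOpen_iff.1 hU _ hx
  obtain ⟨δ, hδ, hVδ⟩ := Metric.isOpen_iff.1 hV _ hy
  have hball : ∀ (z : X) {r : ℝ}, 0 < r → (Metric.ball z (r / 2)).Nonempty := fun z r hr =>
    ⟨z, Metric.mem_ball_self (half_pos hr)⟩
  have htrans : ∀ (z w : X) {r : ℝ}, 0 < r →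
      ∃ m : ℕ, (Metric.ball z (r / 2) ∩ (T ^ m) ⁻¹' Metric.ball w (r / 2)).Nonempty := by
    intro z w r hr
    obtain ⟨m, ⟨u, hu, huw⟩, -⟩ := h _ _ _ Metric.isOpen_ball Metric.isOpen_ball
      Metric.isOpen_ball (hball z hr) (hball w hr) (hball w hr)
    exact ⟨m, u, hu, huw⟩
  obtain ⟨m, hm⟩ := htrans x₁ x₂ hε
  obtain ⟨k, hk⟩ := htrans y₁ y₂ hδ
  -- The target point will be `(u + w, T^m u + T^k w)`: `m` and `k` tie the second coordinates to
  -- the first. Membership in `W` makes `w`, `T^k w` negligible before applying `T^n`, and `T^n u`,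
  -- `T^m T^n u` negligible after.
  let W : Set X := (Metric.ball 0 (ε / 2) ∩ (T ^ k) ⁻¹' Metric.ball 0 (ε / 2)) ∩
    (Metric.ball 0 (δ / 2) ∩ (T ^ m) ⁻¹' Metric.ball 0 (δ / 2))
  have hopen : ∀ (z w : X) (r : ℝ) (m : ℕ),
      IsOpen (Metric.ball z (r / 2) ∩ (T ^ m) ⁻¹' Metric.ball w (r / 2)) := fun z w r m =>
    Metric.isOpen_ball.inter (Metric.isOpen_ball.preimage (T ^ m).continuous)
  have hW : W.Nonempty := ⟨0, by simp [W, half_pos hε, half_pos hδ]⟩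
  obtain ⟨n, ⟨u, hu, huW⟩, w, hw, hwV⟩ := h _ W _ (hopen x₁ x₂ ε m)
    ((hopen _ _ _ _).inter (hopen _ _ _ _)) (hopen y₁ y₂ δ k) hm hW hk
  have comm : ∀ (i : ℕ) (v : X), (T ^ n) ((T ^ i) v) = (T ^ i) ((T ^ n) v) := fun i v => by
    rw [← T.pow_add_apply, ← T.pow_add_apply, add_comm]
  have add_mem : ∀ {r : ℝ} {p q z : X}, p ∈ Metric.ball z (r / 2) → q ∈ Metric.ball 0 (r / 2) →
      p + q ∈ Metric.ball z r := by
    intro r p q z hp hq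
    rw [mem_ball_iff_norm] at hp hq ⊢
    calc ‖p + q - z‖ = ‖(p - z) + (q - 0)‖ := by congr 1; abel
      _ ≤ _ := norm_add_le _ _
      _ < r := by linarith
  refine ⟨n, (u + w, (T ^ m) u + (T ^ k) w), hUε ?_, ?_⟩
  · rw [← ball_prod_same]
    exact ⟨add_mem hu.1 hw.1.1, add_mem hu.2 hw.1.2⟩
  · rw [ContinuousLinearMap.prodMap_pow_apply]
    refine hVδ ?_
    rw [← ball_prod_same]
    refine ⟨?_, ?_⟩
    · simp only [map_add]
      rw [add_comm]
      exact add_mem hwV.1 huW.2.1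
    · simp only [map_add]
      rw [add_comm, comm, comm]
      exact add_mem hwV.2 huW.2.2

/-- A set containing `0` which is not Sidon has a coincidence of sums with one summand strictly
smaller and one strictly larger than the two others. -/
theorem exists_lt_lt_of_not_isSidon {A : Set ℕ} (h : ¬ IsSidon A) :
    ∃ a ∈ A, ∃ b ∈ A, ∃ c ∈ A, ∃ d ∈ A, a < c ∧ a < d ∧ c < b ∧ d < b ∧ a + b = c + d := by
  unfold IsSidon at h
  push Not at h
  obtain ⟨a, ha, b, hb, c, hc, d, hd, hab, hcd, hsum, hne⟩ := h
  rcases lt_trichotomy a c with hac | hac | hac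
  · exact ⟨a, ha, b, hb, c, hc, d, hd, hac, by omega, by omega, by omega, hsum⟩
  · exact absurd (show b = d by omega) (hne hac)
  · exact ⟨c, hc, d, hd, a, ha, b, hb, hac, by omega, by omega, by omega, hsum.symm⟩

/-- With `F` the closure of the range of `T`, the orbit lies in the closed set `{x} ∪ F`, which is
therefore everything. It contains `2x`, and this forces `x ∈ F`. -/
theorem IsHypercyclic.denseRange_pow {T : X →L[𝕜] X} (h : IsHypercyclic T) (m : ℕ) :
    DenseRange (T ^ m) := by
  have hT : DenseRange T := by
    obtain ⟨x, hx⟩ := h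
    let F : Submodule 𝕜 X := T.range.topologicalClosure
    have hFc : IsClosed (F : Set X) := Submodule.isClosed_topologicalClosure _
    have hsub : (Set.range fun n : ℕ => (T ^ n) x) ⊆ insert x (F : Set X) := by
      rintro _ ⟨n, rfl⟩
      rcases n with _ | n
      · exact Or.inl rfl
      · refine Or.inr (Submodule.le_topologicalClosure _ ⟨(T ^ n) x, ?_⟩)
        change T ((T ^ n) x) = (T ^ (n + 1)) x
        rw [pow_succ', mul_apply_eq_comp]
    have hclosed : IsClosed (insert x (F : Set X)) := by
      rw [Set.insert_eq]
      exact isClosed_singleton.union hFc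
    have huniv : ∀ y, y ∈ insert x (F : Set X) := fun y =>
      closure_minimal hsub hclosed (hx y)
    have hxF : x ∈ F := by
      by_contra hxF
      rcases huniv ((2 : 𝕜) • x) with h2 | h2
      · have : x = 0 := by
          rw [two_smul] at h2
          simpa using h2
        exact hxF (this ▸ F.zero_mem)
      · exact hxF ((F.smul_mem_iff two_ne_zero).1 h2)
    intro y
    rcases huniv y with rfl | hy
    · exact hxF
    · exact hy
  induction m with
  | zero => exact Function.surjective_id.denseRange
  | succ m ih =>
    rw [pow_succ]
    exact ih.comp hT (T ^ m).continuous

theorem IsDisjointHypercyclic.isHypercyclic {J : Set ℕ} {T : X →L[𝕜] X}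
    (h : IsDisjointHypercyclic (fun j : J => T ^ (j : ℕ))) (hJ : J.Nonempty) :
    IsHypercyclic T := by
  obtain ⟨x, hx⟩ := h
  obtain ⟨j, hj⟩ := hJ
  refine ⟨x, dense_iff_inter_open.2 fun U hU hUne => ?_⟩
  obtain ⟨n, hn⟩ := hx (fun _ => U) (fun _ => hU) (fun _ => hUne)
  exact ⟨_, hn ⟨j, hj⟩, j * n, by simp [pow_mul]⟩

/-- Adjoins the exponent `0` to `J`: `x` is replaced by an iterate `T^m x` in `F 0`, and the other
targets are pulled back along `T^m`, which has dense range. -/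
theorem IsDisjointHypercyclic.exists_forall_mem {J : Set ℕ} {T : X →L[𝕜] X}
    (h : IsDisjointHypercyclic (fun j : J => T ^ (j : ℕ))) (hJ : J.Nonempty)
    (F : ℕ → Set X) (hF : ∀ j, IsOpen (F j)) (hFne : ∀ j, (F j).Nonempty) :
    ∃ (n : ℕ) (w : X), ∀ j ∈ J ∪ {0}, (T ^ (j * n)) w ∈ F j := by
  have hyp := h.isHypercyclic hJ
  obtain ⟨x, hx⟩ := h
  obtain ⟨j₀, hj₀⟩ := hJ
  obtain ⟨n₀, hn₀⟩ := hx (fun _ => F 0) (fun _ => hF 0) (fun _ => hFne 0)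
  set m := j₀ * n₀
  have hm : (T ^ m) x ∈ F 0 := by
    have := hn₀ ⟨j₀, hj₀⟩
    simpa only [← pow_mul] using this
  obtain ⟨n, hn⟩ := hx (fun j => (T ^ m) ⁻¹' F j) (fun j => (hF j).preimage (T ^ m).continuous)
    (fun j => (hyp.denseRange_pow m).exists_mem_open (hF j) (hFne j))
  refine ⟨n, (T ^ m) x, fun j hj => ?_⟩
  rcases hj with hj | rfl
  · have := hn ⟨j, hj⟩
    simp only [← pow_mul, Set.mem_preimage] at this
    rwa [← T.pow_add_apply, add_comm, T.pow_add_apply]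
  · simpa using hm

theorem IsDisjointHypercyclic.isWeaklyMixing [CompleteSpace X] {J : Set ℕ}
    (hJ : ¬ IsSidon (J ∪ {0})) {T : X →L[𝕜] X}
    (h : IsDisjointHypercyclic (fun j : J => T ^ (j : ℕ))) : IsWeaklyMixing T := by
  have hJne : J.Nonempty := by
    rw [Set.nonempty_iff_ne_empty]
    rintro rfl
    refine hJ fun a ha b hb c hc d hd _ _ _ => ?_
    simp_all
  obtain ⟨a, ha, b, hb, c, hc, d, hd, hac, had, hcb, hdb, hsum⟩ := exists_lt_lt_of_not_isSidon hJ
  have : TopologicalSpace.SeparableSpace X := by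
    obtain ⟨x, hx⟩ := h.isHypercyclic hJne
    exact ⟨_, Set.countable_range _, hx⟩
  have : SecondCountableTopology X := UniformSpace.secondCountable_of_separable X
  refine IsWeaklyMixing.of_three_open_sets fun U V W hU hV hW hUne hVne hWne => ?_
  obtain ⟨n, w, hw⟩ := h.exists_forall_mem hJne
    (fun j => if j = a then U else if j = b then W else V)
    (fun j => by split_ifs <;> assumption) (fun j => by split_ifs <;> assumption)
  refine ⟨(c - a) * n, ⟨(T ^ (a * n)) w, by simpa using hw a ha, ?_⟩,
    (T ^ (d * n)) w, by simpa [had.ne', hdb.ne] using hw d hd, ?_⟩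
  · rw [← T.pow_add_apply, ← add_mul, Nat.sub_add_cancel hac.le]
    simpa [hac.ne', hcb.ne] using hw c hc
  · rw [← T.pow_add_apply, ← add_mul, show c - a + d = b by omega]
    simpa [(hac.trans hcb).ne'] using hw b hb

end WeakMixing

/-! ### Expansions with controlled absolute sum. -/

section Expansion

variable {𝕜 : Type*} [RCLike 𝕜]

/-- `P` is a linear combination of `e 0, …, e (n - 1)` whose coefficients have absolute sum at
most `C`. -/
def HasExpansion (e : ℕ → 𝕜[X]) (n : ℕ) (C : ℝ) (P : 𝕜[X]) : Prop :=
  ∃ v : ℕ → 𝕜, P = ∑ m ∈ Finset.range n, v m • e m ∧ ∑ m ∈ Finset.range n, ‖v m‖ ≤ C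

end Expansion

/-! ### Operators on `ℓ₁` from polynomial bases. -/

section EllOne

variable {𝕜 : Type*} [RCLike 𝕜]

theorem EllOne.single_eq_smul (k : ℕ) (a : 𝕜) :
    (lp.single 1 k a : EllOne 𝕜) = a • (lp.single 1 k (1 : 𝕜) : EllOne 𝕜) := by
  rw [← lp.single_smul, smul_eq_mul, mul_one]

theorem EllOne.norm_single_one (k : ℕ) : ‖(lp.single 1 k (1 : 𝕜) : EllOne 𝕜)‖ = 1 := by
  rw [lp.norm_single one_pos, norm_one]

theorem EllOne.hasSum_smul_single (x : EllOne 𝕜) :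
    HasSum (fun k => x k • (lp.single 1 k (1 : 𝕜) : EllOne 𝕜)) x := by
  simpa only [← EllOne.single_eq_smul] using lp.hasSum_single ENNReal.one_ne_top x

theorem EllOne.hasSum_norm (x : EllOne 𝕜) : HasSum (fun k => ‖x k‖) ‖x‖ := by
  simpa using lp.hasSum_norm (p := 1) (by simp) x

/-- Two continuous linear maps on `ℓ₁` agreeing on the unit vectors are equal. -/
theorem EllOne.clm_ext {F : Type*} [NormedAddCommGroup F] [NormedSpace 𝕜 F]
    {L L' : EllOne 𝕜 →L[𝕜] F}
    (h : ∀ k, L (lp.single 1 k (1 : 𝕜)) = L' (lp.single 1 k (1 : 𝕜))) : L = L' := by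
  ext x
  have h1 := (EllOne.hasSum_smul_single x).mapL L
  have h2 := (EllOne.hasSum_smul_single x).mapL L'
  simp only [map_smul, h] at h1 h2
  exact h1.unique h2

/-- The universal property of `ℓ₁`: bounded sequences extend to continuous linear maps. -/
theorem EllOne.exists_clm {F : Type*} [NormedAddCommGroup F] [NormedSpace 𝕜 F] [CompleteSpace F]
    (b : ℕ → F) (C : ℝ) (hb : ∀ k, ‖b k‖ ≤ C) :
    ∃ L : EllOne 𝕜 →L[𝕜] F, (∀ k, L (lp.single 1 k (1 : 𝕜)) = b k) ∧ ∀ x, ‖L x‖ ≤ C * ‖x‖ := by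
  have hle : ∀ (x : EllOne 𝕜) k, ‖x k • b k‖ ≤ C * ‖x k‖ := fun x k => by
    rw [norm_smul, mul_comm]
    exact mul_le_mul_of_nonneg_right (hb k) (norm_nonneg _)
  have hC : ∀ x : EllOne 𝕜, HasSum (fun k => C * ‖x k‖) (C * ‖x‖) := fun x =>
    (EllOne.hasSum_norm x).mul_left C
  have hs : ∀ x : EllOne 𝕜, Summable fun k => x k • b k := fun x =>
    Summable.of_norm_bounded (hC x).summable (hle x)
  let L : EllOne 𝕜 →ₗ[𝕜] F :=
    { toFun := fun x => ∑' k, x k • b k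
      map_add' := fun x y => by
        rw [← (hs x).tsum_add (hs y)]
        simp [add_smul]
      map_smul' := fun a x => by
        rw [RingHom.id_apply, ← (hs x).tsum_const_smul]
        simp [mul_smul] }
  have hL : ∀ x, ‖L x‖ ≤ C * ‖x‖ := fun x => tsum_of_norm_bounded (hC x) (hle x)
  refine ⟨L.mkContinuous C hL, fun k => ?_, hL⟩
  change ∑' i, (lp.single 1 k (1 : 𝕜) : EllOne 𝕜) i • b i = b k
  rw [tsum_eq_single k fun i hi => by rw [lp.single_apply_ne _ _ _ hi, zero_smul],
    lp.single_apply_self, one_smul]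

/-- A nonzero continuous bilinear form for which `T` is symmetric prevents weak mixing. -/
theorem not_isWeaklyMixing_of_bilin {X : Type*} [NormedAddCommGroup X] [NormedSpace 𝕜 X]
    {T : X →L[𝕜] X} (B : X →L[𝕜] X →L[𝕜] 𝕜) (hB : B ≠ 0) (hT : ∀ x y, B (T x) y = B x (T y)) :
    ¬ IsWeaklyMixing T := by
  rintro ⟨⟨x, y⟩, hxy⟩
  have hpow : ∀ n x y, B ((T ^ n) x) y = B x ((T ^ n) y) := by
    intro n
    induction n with
    | zero => intro x y; rfl
    | succ n ih =>
      intro x y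
      calc B ((T ^ (n + 1)) x) y = B (T ((T ^ n) x)) y := by rw [pow_succ', mul_apply_eq_comp]
        _ = B x ((T ^ n) (T y)) := by rw [hT, ih]
        _ = B x ((T ^ (n + 1)) y) := by rw [pow_succ, mul_apply_eq_comp]
  -- By symmetry both sides agree on the orbit of `(x, y)`, hence everywhere; but they depend on
  -- different coordinates, so both vanish.
  have key : ∀ p : X × X, B p.1 y = B x p.2 := by
    have : (fun p : X × X => B p.1 y) = fun p => B x p.2 := by
      refine Continuous.ext_on hxy (by fun_prop) (by fun_prop) ?_
      rintro _ ⟨n, rfl⟩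
      simp only [T.prodMap_pow_apply, hpow]
    exact congrFun this
  have hy : ∀ u, B u y = 0 := fun u => by simpa using key (u, 0)
  refine hB (ContinuousLinearMap.ext fun u => ContinuousLinearMap.ext fun w => ?_)
  have : (fun p : X × X => B u p.2) = fun _ => 0 := by
    refine Continuous.ext_on hxy (by fun_prop) (by fun_prop) ?_
    rintro _ ⟨n, rfl⟩
    simp only [T.prodMap_pow_apply, ← hpow, hy]
  exact congrFun this (0, w)

/-- An `ℓ₁`-norm on `𝕜[X]` given by a basis `e` for which multiplication by `X` is bounded and
`(P, Q) ↦ φ (P * Q)` is bounded gives a non weakly mixing operator on `ℓ₁`. -/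
theorem exists_operator_of_basis (e : ℕ → 𝕜[X]) (he : ∀ k, (e k).degree = k)
    (φ : 𝕜[X] →ₗ[𝕜] 𝕜) (hφ : φ ≠ 0) {C C' : ℝ}
    (hφe : ∀ k l, ‖φ (e k * e l)‖ ≤ C') (hX : ∀ k, HasExpansion e (k + 2) C (X * e k)) :
    ∃ (T : EllOne 𝕜 →L[𝕜] EllOne 𝕜) (ι : 𝕜[X] →ₗ[𝕜] EllOne 𝕜),
      DenseRange ι ∧ (∀ k, ‖ι (e k)‖ = 1) ∧ (∀ n P, (T ^ n) (ι P) = ι (X ^ n * P)) ∧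
        ¬ IsWeaklyMixing T := by
  let S : Polynomial.Sequence 𝕜 := ⟨e, he⟩
  let b := S.basis fun i => (leadingCoeff_ne_zero.2 (S.ne_zero i)).isUnit
  have hb : ∀ k, b k = e k := fun k => Polynomial.Sequence.basis_eq_self _ _ _
  let ι : 𝕜[X] →ₗ[𝕜] EllOne 𝕜 := b.constr 𝕜 fun k => (lp.single 1 k (1 : 𝕜) : EllOne 𝕜)
  have hι : ∀ k, ι (e k) = lp.single 1 k (1 : 𝕜) := fun k => by
    rw [← hb]; exact b.constr_basis 𝕜 _ k
  have hιn : ∀ k, ‖ι (e k)‖ = 1 := fun k => by rw [hι, EllOne.norm_single_one]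
  have hιX : ∀ k, ‖ι (X * e k)‖ ≤ C := fun k => by
    obtain ⟨v, hv, hvC⟩ := hX k
    rw [hv, map_sum]
    refine (norm_sum_le _ _).trans (le_trans (Finset.sum_le_sum fun m _ => ?_) hvC)
    rw [map_smul, norm_smul, hιn, mul_one]
  obtain ⟨T, hT, -⟩ := EllOne.exists_clm (𝕜 := 𝕜) (fun k => ι (X * e k)) C hιX
  have hTι : ∀ P, T (ι P) = ι (X * P) := by
    have : T.toLinearMap ∘ₗ ι = ι ∘ₗ LinearMap.mulLeft 𝕜 (X : 𝕜[X]) := by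
      refine b.ext fun k => ?_
      simp [hb, hι, hT]
    exact LinearMap.congr_fun this
  -- The bilinear form arises from the universal property of `ℓ₁`, applied in each variable in turn.
  choose β hβ hβn using fun k =>
    EllOne.exists_clm (𝕜 := 𝕜) (fun l => φ (e k * e l)) C' (hφe k)
  have hC' : 0 ≤ C' := (norm_nonneg _).trans (hφe 0 0)
  obtain ⟨B, hB, -⟩ := EllOne.exists_clm (𝕜 := 𝕜) β C' fun k =>
    ContinuousLinearMap.opNorm_le_bound _ hC' (hβn k)
  have hBι : ∀ P Q, B (ι P) (ι Q) = φ (P * Q) := by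
    intro P Q
    have h1 : ∀ k, (B (ι (e k))).toLinearMap ∘ₗ ι = φ ∘ₗ LinearMap.mulLeft 𝕜 (e k) := by
      intro k
      refine b.ext fun l => ?_
      simp [hb, hι, hB, hβ]
    have h2 : (B.flip (ι Q)).toLinearMap ∘ₗ ι = φ ∘ₗ LinearMap.mulRight 𝕜 Q := by
      refine b.ext fun k => ?_
      simpa [hb] using LinearMap.congr_fun (h1 k) Q
    simpa using LinearMap.congr_fun h2 P
  refine ⟨T, ι, ?_, hιn, fun n P => ?_, not_isWeaklyMixing_of_bilin B ?_ ?_⟩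
  · intro x
    have : x ∈ ι.range.topologicalClosure := by
      refine isClosed_closure.mem_of_tendsto (EllOne.hasSum_smul_single x)
        (Filter.Eventually.of_forall fun s => subset_closure ?_)
      refine Submodule.sum_mem _ fun k _ => Submodule.smul_mem _ _ ⟨e k, hι k⟩
    exact this
  · induction n with
    | zero => simp
    | succ n ih =>
      rw [pow_succ', mul_apply_eq_comp, ih, hTι, pow_succ', mul_assoc]
  · rintro rfl
    refine hφ (LinearMap.ext fun P => ?_)
    simpa using (hBι 1 P).symm
  · intro x y
    have h : B.comp T = ((B.flip).comp T).flip := by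
      refine EllOne.clm_ext fun k => EllOne.clm_ext fun l => ?_
      simp only [ContinuousLinearMap.comp_apply, ContinuousLinearMap.flip_apply, ← hι, hTι, hBι]
      ring_nf
    exact congrArg (fun L => L x y) h

end EllOne

/-! ### Calculus of expansions. -/

section Expansion

variable {𝕜 : Type*} [RCLike 𝕜]

theorem HasExpansion.congr {e e' : ℕ → 𝕜[X]} {n : ℕ} {C : ℝ} {P : 𝕜[X]}
    (h : HasExpansion e n C P) (he : ∀ m < n, e' m = e m) : HasExpansion e' n C P := by
  obtain ⟨v, hv, hC⟩ := h
  refine ⟨v, hv.trans (Finset.sum_congr rfl fun m hm => ?_), hC⟩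
  rw [he m (Finset.mem_range.1 hm)]

theorem HasExpansion.mono {e : ℕ → 𝕜[X]} {n n' : ℕ} {C C' : ℝ} {P : 𝕜[X]}
    (h : HasExpansion e n C P) (hn : n ≤ n') (hC : C ≤ C') : HasExpansion e n' C' P := by
  obtain ⟨v, hv, hv'⟩ := h
  have hf : (Finset.range n').filter (· < n) = Finset.range n := by
    ext m; simp only [Finset.mem_filter, Finset.mem_range]; omega
  refine ⟨fun m => if m < n then v m else 0, ?_, ?_⟩
  · simp only [ite_smul, zero_smul]
    rw [← Finset.sum_filter, hf, hv]
  · simp only [apply_ite (norm : 𝕜 → ℝ), norm_zero]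
    rw [← Finset.sum_filter, hf]
    exact hv'.trans hC

theorem HasExpansion.add {e : ℕ → 𝕜[X]} {n : ℕ} {C C' : ℝ} {P Q : 𝕜[X]}
    (h : HasExpansion e n C P) (h' : HasExpansion e n C' Q) :
    HasExpansion e n (C + C') (P + Q) := by
  obtain ⟨v, hv, hC⟩ := h
  obtain ⟨w, hw, hC'⟩ := h'
  refine ⟨fun m => v m + w m, ?_, ?_⟩
  · simp only [add_smul, Finset.sum_add_distrib, ← hv, ← hw]
  · refine (Finset.sum_le_sum fun m _ => norm_add_le _ _).trans ?_
    rw [Finset.sum_add_distrib]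
    exact add_le_add hC hC'

theorem HasExpansion.smul {e : ℕ → 𝕜[X]} {n : ℕ} {C : ℝ} {P : 𝕜[X]}
    (h : HasExpansion e n C P) (a : 𝕜) : HasExpansion e n (‖a‖ * C) (a • P) := by
  obtain ⟨v, hv, hC⟩ := h
  refine ⟨fun m => a * v m, ?_, ?_⟩
  · simp only [mul_smul, ← Finset.smul_sum, ← hv]
  · simp only [norm_mul, ← Finset.mul_sum]
    exact mul_le_mul_of_nonneg_left hC (norm_nonneg _)

theorem HasExpansion.self (e : ℕ → 𝕜[X]) {n m : ℕ} (hm : m < n) : HasExpansion e n 1 (e m) := by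
  refine ⟨fun i => if i = m then 1 else 0, ?_, ?_⟩
  · simp [hm]
  · simp [apply_ite (norm : 𝕜 → ℝ), hm]

theorem HasExpansion.sum {ι : Type*} {e : ℕ → 𝕜[X]} {n : ℕ} {C : ι → ℝ} {P : ι → 𝕜[X]}
    (s : Finset ι) (h : ∀ i ∈ s, HasExpansion e n (C i) (P i)) :
    HasExpansion e n (∑ i ∈ s, C i) (∑ i ∈ s, P i) := by
  classical
  induction s using Finset.induction_on with
  | empty => exact ⟨0, by simp, by simp⟩
  | insert i s hi ih =>
    rw [Finset.sum_insert hi, Finset.sum_insert hi]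
    exact (h i (Finset.mem_insert_self _ _)).add
      (ih fun j hj => h j (Finset.mem_insert_of_mem hj))

theorem exists_hasExpansion {e : ℕ → 𝕜[X]} (he : ∀ k, (e k).degree = k) {n : ℕ} {P : 𝕜[X]}
    (hP : P.natDegree < n) : ∃ W, HasExpansion e n W P := by
  let S : Polynomial.Sequence 𝕜 := ⟨e, he⟩
  have hspan := S.span_degreeLT (m := n)
    fun i _ => (leadingCoeff_ne_zero.2 (S.ne_zero i)).isUnit
  have hmem : P ∈ Submodule.span 𝕜 (S '' Set.Iio n) := by
    rw [hspan, mem_degreeLT]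
    exact (degree_le_natDegree).trans_lt (by exact_mod_cast hP)
  rw [← Finset.coe_range, Submodule.mem_span_image_finset_iff_exists_fun] at hmem
  obtain ⟨v, hv⟩ := hmem
  refine ⟨_, fun m => if h : m ∈ Finset.range n then v ⟨m, h⟩ else 0, ?_, le_rfl⟩
  rw [← hv, ← Finset.sum_coe_sort (Finset.range n)]
  exact Finset.sum_congr rfl fun m _ => by
    change _ = dite _ _ _ • _
    rw [dif_pos m.2]

end Expansion

/-! ### Functionals given by moments. -/

section Moment

variable {𝕜 : Type*} [RCLike 𝕜]

/-- The linear functional on `𝕜[X]` sending `X ^ k` to `c k`. -/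
noncomputable def moment (c : ℕ → 𝕜) : 𝕜[X] →ₗ[𝕜] 𝕜 := (basisMonomials 𝕜).constr 𝕜 c

theorem moment_X_pow (c : ℕ → 𝕜) (k : ℕ) : moment c (X ^ k) = c k := by
  have := (basisMonomials 𝕜).constr_basis 𝕜 c k
  simp only [coe_basisMonomials, monomial_one_right_eq_X_pow] at this
  exact this

theorem Polynomial.X_pow_mul_eq_sum_smul (m : ℕ) {Q : 𝕜[X]} {n : ℕ} (hQ : Q.natDegree < n) :
    X ^ m * Q = ∑ i ∈ Finset.range n, Q.coeff i • (X ^ (m + i) : 𝕜[X]) := by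
  conv_lhs => rw [Q.as_sum_range' n hQ, Finset.mul_sum]
  refine Finset.sum_congr rfl fun i _ => ?_
  rw [← smul_X_eq_monomial, mul_smul_comm, pow_add]

theorem moment_X_pow_mul (c : ℕ → 𝕜) (m : ℕ) {Q : 𝕜[X]} {n : ℕ} (hQ : Q.natDegree < n) :
    moment c (X ^ m * Q) = ∑ i ∈ Finset.range n, Q.coeff i * c (m + i) := by
  rw [Polynomial.X_pow_mul_eq_sum_smul m hQ, map_sum]
  simp only [map_smul, moment_X_pow, smul_eq_mul]

theorem moment_congr {c c' : ℕ → 𝕜} {Q : 𝕜[X]} {n : ℕ} (hQ : Q.natDegree < n)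
    (h : ∀ i < n, c i = c' i) : moment c Q = moment c' Q := by
  have h1 := moment_X_pow_mul c 0 hQ
  have h2 := moment_X_pow_mul c' 0 hQ
  simp only [pow_zero, one_mul, zero_add] at h1 h2
  rw [h1, h2]
  exact Finset.sum_congr rfl fun i hi => by rw [h i (Finset.mem_range.1 hi)]

/-- The sum of the absolute values of the coefficients. -/
noncomputable def coeffNorm (Q : 𝕜[X]) : ℝ := ∑ i ∈ Finset.range (Q.natDegree + 1), ‖Q.coeff i‖

theorem coeffNorm_nonneg (Q : 𝕜[X]) : 0 ≤ coeffNorm Q :=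
  Finset.sum_nonneg fun _ _ => norm_nonneg _

theorem coeffNorm_X_pow (k : ℕ) : coeffNorm (X ^ k : 𝕜[X]) = 1 := by
  simp [coeffNorm, coeff_X_pow, apply_ite (norm : 𝕜 → ℝ)]

theorem norm_moment_X_pow_mul_le {c : ℕ → 𝕜} {K : ℝ} (hc : ∀ k, ‖c k‖ ≤ K) (m : ℕ) (Q : 𝕜[X]) :
    ‖moment c (X ^ m * Q)‖ ≤ K * coeffNorm Q := by
  rw [moment_X_pow_mul c m (Nat.lt_succ_self _), coeffNorm, Finset.mul_sum]
  refine (norm_sum_le _ _).trans (Finset.sum_le_sum fun i _ => ?_)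
  rw [norm_mul, mul_comm]
  exact mul_le_mul_of_nonneg_right (hc _) (norm_nonneg _)

theorem moment_X_pow_mul_eq_zero {c : ℕ → 𝕜} {m : ℕ} (hc : ∀ k, m ≤ k → c k = 0) {k : ℕ}
    (hk : m ≤ k) (Q : 𝕜[X]) : moment c (X ^ k * Q) = 0 := by
  rw [moment_X_pow_mul c k (Nat.lt_succ_self _)]
  exact Finset.sum_eq_zero fun i _ => by rw [hc _ (by omega), mul_zero]

/-- The moments given blockwise by `c (q * N + i) = moment c (X ^ i * G q)`, for `i < N`. -/
noncomputable def blockMoments (c : ℕ → 𝕜) (G : ℕ → 𝕜[X]) (N k : ℕ) : 𝕜 :=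
  moment c (X ^ (k % N) * G (k / N))

/-- Under the new functional `X ^ (q * N)` acts as `G q`, as long as the cofactor fits in one block.
-/
theorem moment_blockMoments (c : ℕ → 𝕜) (G : ℕ → 𝕜[X]) {N : ℕ} (q : ℕ) {Q : 𝕜[X]}
    (hQ : Q.natDegree < N) :
    moment (blockMoments c G N) (X ^ (q * N) * Q) = moment c (Q * G q) := by
  have hQs := Polynomial.X_pow_mul_eq_sum_smul 0 hQ
  rw [pow_zero, one_mul] at hQs
  rw [moment_X_pow_mul _ _ hQ]
  conv_rhs => rw [hQs, Finset.sum_mul, map_sum]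
  refine Finset.sum_congr rfl fun i hi => ?_
  rw [Finset.mem_range] at hi
  rw [smul_mul_assoc, map_smul, smul_eq_mul, zero_add, blockMoments, add_comm (q * N) i,
    Nat.add_mul_mod_self_right, Nat.mod_eq_of_lt hi, Nat.add_mul_div_right _ _ (by omega),
    Nat.div_eq_of_lt hi, zero_add]

theorem moment_blockMoments_of_lt (c : ℕ → 𝕜) {G : ℕ → 𝕜[X]} (hG : G 0 = 1) {N : ℕ} {Q : 𝕜[X]}
    (hQ : Q.natDegree < N) : moment (blockMoments c G N) Q = moment c Q := by
  simpa [hG] using moment_blockMoments c G 0 hQ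

end Moment

/-! ### Where the Sidon property enters. -/

section Products

variable {R : Type*} [CommSemiring R]

/-- For a Sidon set `J ∪ {0}`, products `P i * P j` only depend on `i + j`. -/
theorem exists_product_function_of_isSidon {J : Finset ℕ} (hJ : IsSidon ((J : Set ℕ) ∪ {0}))
    (hJ0 : ∀ j ∈ J, 0 < j) (P : ℕ → R) :
    ∃ (G : ℕ → R) (q₀ : ℕ), G 0 = 1 ∧ (∀ j ∈ J, G j = P j) ∧
      (∀ i ∈ J, ∀ j ∈ J, G (i + j) = P i * P j) ∧ (∀ q, q₀ ≤ q → G q = 0) ∧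
      ∀ j ∈ J, j < q₀ := by
  classical
  let P' : ℕ → R := fun j => if j = 0 then 1 else P j
  let IsPair : ℕ → ℕ × ℕ → Prop := fun q p =>
    p.1 ∈ (J : Set ℕ) ∪ {0} ∧ p.2 ∈ (J : Set ℕ) ∪ {0} ∧ p.1 ≤ p.2 ∧ p.1 + p.2 = q
  let G : ℕ → R := fun q =>
    if h : ∃ p, IsPair q p then P' h.choose.1 * P' h.choose.2 else 0
  have hG' : ∀ i ∈ (J : Set ℕ) ∪ {0}, ∀ j ∈ (J : Set ℕ) ∪ {0}, i ≤ j →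
      G (i + j) = P' i * P' j := by
    intro i hi j hj hij
    have h : ∃ p, IsPair (i + j) p := ⟨(i, j), hi, hj, hij, rfl⟩
    obtain ⟨h1, h2, h3, h4⟩ := h.choose_spec
    -- Uniqueness of the ordered pair with a given sum: the only use of the Sidon property in the
    -- construction.
    obtain ⟨h5, h6⟩ := hJ _ h1 _ h2 _ hi _ hj h3 hij h4
    simp only [G, dif_pos h, h5, h6]
  have hG : ∀ i ∈ (J : Set ℕ) ∪ {0}, ∀ j ∈ (J : Set ℕ) ∪ {0}, G (i + j) = P' i * P' j := by
    intro i hi j hj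
    rcases le_total i j with h | h
    · exact hG' i hi j hj h
    · rw [add_comm, mul_comm, hG' j hj i hi h]
  have hP' : ∀ j ∈ J, P' j = P j := fun j hj => if_neg (hJ0 j hj).ne'
  have hmem : ∀ j ∈ J, j ∈ (J : Set ℕ) ∪ {0} := fun j hj => Or.inl hj
  refine ⟨G, 2 * J.sup id + 1, ?_, fun j hj => ?_, fun i hi j hj => ?_, fun q hq => ?_,
    fun j hj => ?_⟩
  · simpa [P'] using hG 0 (Or.inr rfl) 0 (Or.inr rfl)
  · have := hG 0 (Or.inr rfl) j (hmem j hj)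
    rw [zero_add, hP' j hj] at this
    simpa [P'] using this
  · rw [hG i (hmem i hi) j (hmem j hj), hP' i hi, hP' j hj]
  · refine dif_neg ?_
    rintro ⟨⟨i, j⟩, hi, hj, -, hij⟩
    have hle : ∀ i ∈ (J : Set ℕ) ∪ {0}, i ≤ J.sup id := by
      rintro i (hi | rfl)
      · exact Finset.le_sup (f := id) hi
      · exact Nat.zero_le _
    have h1 := hle i hi
    have h2 := hle j hj
    simp only at hij
    omega
  · have : j ≤ J.sup id := Finset.le_sup (f := id) hj
    omega

end Products

/-! ### Stages and their extension. -/

section Stage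

variable {𝕜 : Type*} [RCLike 𝕜]

/-- A basis of `𝕜[X]` and a functional with the required bounds, trivial beyond degree `M`. -/
structure IsStage (e : ℕ → 𝕜[X]) (c : ℕ → 𝕜) (M : ℕ) : Prop where
  degree_eq : ∀ k, (e k).degree = k
  eq_X_pow : ∀ k, M ≤ k → e k = X ^ k
  moment_eq_zero : ∀ k, M ≤ k → c k = 0
  expansion : ∀ k, HasExpansion e (k + 2) 4 (X * e k)
  bound : ∀ k l, ‖moment c (e k * e l)‖ ≤ 1

theorem IsStage.mono {e : ℕ → 𝕜[X]} {c : ℕ → 𝕜} {M M' : ℕ} (h : IsStage e c M) (hM : M ≤ M') :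
    IsStage e c M' :=
  { h with
    eq_X_pow := fun k hk => h.eq_X_pow k (hM.trans hk)
    moment_eq_zero := fun k hk => h.moment_eq_zero k (hM.trans hk) }

/-- Weights which equal `1` up to `M`, then decrease by factors `2` to `2 ^ (-s)`, and jump back
to `1` at `M'`. -/
noncomputable def dipWeight (M s M' k : ℕ) : ℝ :=
  if k < M' then (1 / 2) ^ min (k - M) s else 1

theorem dipWeight_pos (M s M' k : ℕ) : 0 < dipWeight M s M' k := by
  unfold dipWeight; split_ifs <;> positivity

theorem dipWeight_le_one (M s M' k : ℕ) : dipWeight M s M' k ≤ 1 := by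
  unfold dipWeight
  split_ifs
  · exact pow_le_one₀ (by norm_num) (by norm_num)
  · exact le_rfl

theorem le_dipWeight (M s M' k : ℕ) : (1 / 2) ^ s ≤ dipWeight M s M' k := by
  unfold dipWeight
  split_ifs
  · exact pow_le_pow_of_le_one (by norm_num) (by norm_num) (min_le_right _ _)
  · exact pow_le_one₀ (by norm_num) (by norm_num)

theorem dipWeight_eq {M s M' k : ℕ} (hk : M + s ≤ k) (hk' : k < M') :
    dipWeight M s M' k = (1 / 2) ^ s := by
  rw [dipWeight, if_pos hk', min_eq_right (by omega)]

/-- Multiplication by `X` costs the ratio of consecutive weights, so descents go by halves, while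
the jump up at `M'` is free. -/
theorem dipWeight_le_two_mul (M s M' k : ℕ) :
    dipWeight M s M' k ≤ 2 * dipWeight M s M' (k + 1) := by
  by_cases hk : k + 1 < M'
  · rw [dipWeight, dipWeight, if_pos hk, if_pos (by omega)]
    have h : min (k + 1 - M) s ≤ min (k - M) s + 1 := by omega
    have := pow_le_pow_of_le_one (a := (1 / 2 : ℝ)) (by norm_num) (by norm_num) h
    rw [pow_succ] at this
    linarith
  · have h1 := dipWeight_le_one M s M' k
    have h2 : dipWeight M s M' (k + 1) = 1 := if_neg hk
    linarith

/-- The basis of the next stage. -/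
noncomputable def nextBasis (e : ℕ → 𝕜[X]) (M s : ℕ) (J : Finset ℕ) (P : ℕ → 𝕜[X]) (a : ℝ)
    (L N M' k : ℕ) : 𝕜[X] :=
  if k < M then e k
  else if k / N ∈ J ∧ k % N ≤ L then
    -- Offset `0` is the required vector. Along the block multiplication by `X` only doubles, and at
    -- offset `L` the factor is small enough to leave the block.
    ((a * (1 / 2) ^ (k % N) : ℝ) : 𝕜) • (X ^ (k % N) * (X ^ (k / N * N) - P (k / N)))
  else ((dipWeight M s M' k : ℝ) : 𝕜) • X ^ k

/-- The parameters of the extension of a stage and the estimates which they have to satisfy. -/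
structure IsExtension (e : ℕ → 𝕜[X]) (c : ℕ → 𝕜) (M s : ℕ) (J : Finset ℕ) (P : ℕ → 𝕜[X]) (a : ℝ)
    (G : ℕ → 𝕜[X]) (q₀ L N : ℕ) (K : ℝ) : Prop where
  stage : IsStage e c M
  pos : ∀ j ∈ J, 0 < j
  lt : ∀ j ∈ J, j < q₀
  q₀_pos : 0 < q₀
  natDegree_lt : ∀ j ∈ J, (P j).natDegree < M
  G_zero : G 0 = 1
  G_mem : ∀ j ∈ J, G j = P j
  G_add : ∀ i ∈ J, ∀ j ∈ J, G (i + j) = P i * P j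
  G_large : ∀ q, q₀ ≤ q → G q = 0
  one_le : 1 ≤ a
  exists_expansion : ∀ j ∈ J, ∃ W, HasExpansion e M W (P j) ∧ W ≤ 2 ^ s
  le_two_pow_L : ∀ j ∈ J, a * (1 + coeffNorm (P j)) * 2 ^ s ≤ 2 ^ L
  le_L : M ≤ L
  -- Keeps within one block all products of two low vectors, and all cofactors of the special
  -- differences, including the factors `P j`.
  le_N : 2 * (M + s + L) + 2 ≤ N
  norm_le : ∀ k, ‖blockMoments c G N k‖ ≤ K
  -- With `special_le`, this bounds the pairing of any `X ^ k` with any basis vector by `2 ^ s`,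
  -- which the weight `2 ^ (-s)` compensates.
  coeffNorm_le : ∀ l, K * coeffNorm (e l) ≤ 2 ^ s
  special_le : ∀ j ∈ J, a * (K * (1 + coeffNorm (P j))) ≤ 2 ^ s

namespace IsExtension

variable {e : ℕ → 𝕜[X]} {c : ℕ → 𝕜} {M s : ℕ} {J : Finset ℕ} {P : ℕ → 𝕜[X]} {a : ℝ}
  {G : ℕ → 𝕜[X]} {q₀ L N : ℕ} {K : ℝ}

theorem N_pos (h : IsExtension e c M s J P a G q₀ L N K) : 0 < N := by have := h.le_N; omega

theorem N_le (h : IsExtension e c M s J P a G q₀ L N K)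
    : N ≤ q₀ * N := Nat.le_mul_of_pos_left N h.q₀_pos

theorem mul_add_lt (h : IsExtension e c M s J P a G q₀ L N K)
    {j i : ℕ} (hj : j ∈ J) (hi : i < N) : j * N + i < q₀ * N := by
  have h1 : (j + 1) * N ≤ q₀ * N := Nat.mul_le_mul_right N (h.lt j hj)
  rw [add_mul, one_mul] at h1
  omega

theorem le_mul (h : IsExtension e c M s J P a G q₀ L N K)
    {j : ℕ} (hj : j ∈ J) : N ≤ j * N := Nat.le_mul_of_pos_left N (h.pos j hj)

theorem div_notMem (h : IsExtension e c M s J P a G q₀ L N K)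
    {k : ℕ} (hk : k < N) : k / N ∉ J := fun hj => by
  have := h.pos _ hj
  rw [Nat.div_eq_of_lt hk] at this
  exact lt_irrefl _ this

theorem div_mod (h : IsExtension e c M s J P a G q₀ L N K)
    {j i : ℕ} (hi : i ≤ L) : (j * N + i) / N = j ∧ (j * N + i) % N = i := by
  have h1 := h.le_N
  have h2 := h.N_pos
  rw [add_comm]
  exact ⟨by rw [Nat.add_mul_div_right _ _ h2, Nat.div_eq_of_lt (by omega), zero_add],
    by rw [Nat.add_mul_mod_self_right, Nat.mod_eq_of_lt (by omega)]⟩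

theorem nextBasis_of_le (h : IsExtension e c M s J P a G q₀ L N K)
    {k : ℕ} (hk : k ≤ M) : nextBasis e M s J P a L N (q₀ * N) k = e k := by
  unfold nextBasis
  split_ifs with h1 h2
  · rfl
  · have := h.le_N
    exact absurd h2.1 (h.div_notMem (by omega))
  · have hkM : k = M := by omega
    have hw : dipWeight M s (q₀ * N) k = 1 := by simp [dipWeight, hkM]
    rw [hw, h.stage.eq_X_pow k hkM.ge]
    simp

theorem nextBasis_special (h : IsExtension e c M s J P a G q₀ L N K)
    {j i : ℕ} (hj : j ∈ J) (hi : i ≤ L) :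
    nextBasis e M s J P a L N (q₀ * N) (j * N + i) =
      ((a * (1 / 2) ^ i : ℝ) : 𝕜) • (X ^ i * (X ^ (j * N) - P j)) := by
  obtain ⟨h1, h2⟩ := h.div_mod (j := j) hi
  have h3 := h.le_N
  have h4 := h.le_mul hj
  rw [nextBasis, if_neg (by omega), h1, h2, if_pos ⟨hj, hi⟩]

theorem nextBasis_of_not {k : ℕ} (hk : M ≤ k) (hk' : ¬ (k / N ∈ J ∧ k % N ≤ L)) :
    nextBasis e M s J P a L N (q₀ * N) k =
      ((dipWeight M s (q₀ * N) k : ℝ) : 𝕜) • X ^ k := by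
  rw [nextBasis, if_neg (by omega), if_neg hk']

theorem X_pow_eq {k : ℕ} (hk : M ≤ k) (hk' : ¬ (k / N ∈ J ∧ k % N ≤ L)) :
    (X ^ k : 𝕜[X]) = (((dipWeight M s (q₀ * N) k)⁻¹ : ℝ) : 𝕜) •
      nextBasis e M s J P a L N (q₀ * N) k := by
  rw [nextBasis_of_not hk hk', smul_smul, ← RCLike.ofReal_mul,
    inv_mul_cancel₀ (dipWeight_pos _ _ _ _).ne', RCLike.ofReal_one, one_smul]

theorem hasExpansion_X_pow {k n : ℕ} (hk : M ≤ k) (hk' : ¬ (k / N ∈ J ∧ k % N ≤ L))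
    (hn : k < n) :
    HasExpansion (nextBasis e M s J P a L N (q₀ * N)) n (dipWeight M s (q₀ * N) k)⁻¹
      (X ^ k) := by
  rw [X_pow_eq hk hk']
  refine ((HasExpansion.self _ hn).smul _).mono le_rfl ?_
  rw [RCLike.norm_ofReal, abs_of_pos (inv_pos.2 (dipWeight_pos _ _ _ _)), mul_one]

theorem degree_X_pow_sub (h : IsExtension e c M s J P a G q₀ L N K)
    {j : ℕ} (hj : j ∈ J) : (X ^ (j * N) - P j).degree =
    ((j * N : ℕ) : WithBot ℕ) := by
  have h1 := h.natDegree_lt j hj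
  have h2 := h.le_mul hj
  have h3 := h.le_N
  rw [degree_sub_eq_left_of_degree_lt, degree_X_pow]
  rw [degree_X_pow]
  exact degree_le_natDegree.trans_lt (by exact_mod_cast (by omega))

theorem special_pos (h : IsExtension e c M s J P a G q₀ L N K) (i : ℕ) : 0 < a * (1 / 2) ^ i :=
  mul_pos (zero_lt_one.trans_le h.one_le) (by positivity)

theorem special_le_a (h : IsExtension e c M s J P a G q₀ L N K) (i : ℕ) : a * (1 / 2) ^ i ≤ a :=
  mul_le_of_le_one_right (zero_le_one.trans h.one_le) (pow_le_one₀ (by norm_num) (by norm_num))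

/-- The four kinds of basis vectors. -/
theorem nextBasis_cases (h : IsExtension e c M s J P a G q₀ L N K) (k : ℕ) :
    (k < M + s ∧ ∃ r : ℝ, 0 ≤ r ∧ r ≤ 1 ∧
      nextBasis e M s J P a L N (q₀ * N) k = (r : 𝕜) • e k) ∨
    (∃ j ∈ J, ∃ i ≤ L, k = j * N + i) ∨
    (nextBasis e M s J P a L N (q₀ * N) k = (((1 / 2) ^ s : ℝ) : 𝕜) • X ^ k) ∨
    (q₀ * N ≤ k ∧ nextBasis e M s J P a L N (q₀ * N) k = X ^ k) := by
  by_cases hk : k / N ∈ J ∧ k % N ≤ L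
  · exact Or.inr (Or.inl ⟨_, hk.1, _, hk.2, (Nat.div_add_mod' k N).symm⟩)
  rcases lt_or_ge k M with hkM | hkM
  · exact Or.inl ⟨by omega, 1, zero_le_one, le_rfl, by simp [h.nextBasis_of_le hkM.le]⟩
  rw [nextBasis_of_not hkM hk]
  rcases lt_or_ge k (M + s) with hks | hks
  · exact Or.inl ⟨hks, _, (dipWeight_pos _ _ _ _).le, dipWeight_le_one _ _ _ _,
      by rw [h.stage.eq_X_pow k hkM]⟩
  rcases lt_or_ge k (q₀ * N) with hkq | hkq
  · exact Or.inr (Or.inr (Or.inl (by rw [dipWeight_eq hks hkq])))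
  · refine Or.inr (Or.inr (Or.inr ⟨hkq, ?_⟩))
    rw [dipWeight, if_neg (by omega), RCLike.ofReal_one, one_smul]

theorem nextBasis_of_large (h : IsExtension e c M s J P a G q₀ L N K) {k : ℕ} (hk : q₀ * N ≤ k) :
    nextBasis e M s J P a L N (q₀ * N) k = X ^ k := by
  have h1 := h.le_N
  have h2 := h.N_le
  rw [nextBasis_of_not (by omega), dipWeight, if_neg (by omega), RCLike.ofReal_one, one_smul]
  rintro ⟨hj, -⟩
  have := h.lt _ hj
  rw [Nat.div_lt_iff_lt_mul h.N_pos] at this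
  omega

theorem nextBasis_degree (h : IsExtension e c M s J P a G q₀ L N K)
    (k : ℕ) : (nextBasis e M s J P a L N (q₀ * N) k).degree = k := by
  by_cases hk : k / N ∈ J ∧ k % N ≤ L
  · rw [← Nat.div_add_mod' k N, h.nextBasis_special hk.1 hk.2,
      degree_smul_of_smul_regular _
        (IsSMulRegular.of_ne_zero (by exact_mod_cast (h.special_pos _).ne')),
      degree_mul, degree_X_pow, h.degree_X_pow_sub hk.1]
    push_cast
    rw [add_comm]
  rcases lt_or_ge k M with hkM | hkM
  · rw [h.nextBasis_of_le hkM.le, h.stage.degree_eq]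
  · rw [nextBasis_of_not hkM hk,
      degree_smul_of_smul_regular _
        (IsSMulRegular.of_ne_zero (by exact_mod_cast (dipWeight_pos _ _ _ _).ne')),
      degree_X_pow]

theorem blockMoments_of_large (h : IsExtension e c M s J P a G q₀ L N K)
    {k : ℕ} (hk : q₀ * N ≤ k) : blockMoments c G N k = 0 := by
  rw [blockMoments, h.G_large _ ((Nat.le_div_iff_mul_le h.N_pos).2 hk), mul_zero, map_zero]

theorem blockMoments_of_lt (h : IsExtension e c M s J P a G q₀ L N K)
    {k : ℕ} (hk : k < N) : blockMoments c G N k = c k := by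
  rw [← moment_X_pow (blockMoments c G N), moment_blockMoments_of_lt c h.G_zero (by rwa [natDegree_X_pow]),
    moment_X_pow]

end IsExtension

end Stage

/-! ### Bounds for the next stage. -/

section Stage

variable {𝕜 : Type*} [RCLike 𝕜]

namespace IsExtension

variable {e : ℕ → 𝕜[X]} {c : ℕ → 𝕜} {M s : ℕ} {J : Finset ℕ} {P : ℕ → 𝕜[X]} {a : ℝ}
  {G : ℕ → 𝕜[X]} {q₀ L N : ℕ} {K : ℝ}

theorem expansion_of_special (h : IsExtension e c M s J P a G q₀ L N K) {j i : ℕ} (hj : j ∈ J)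
    (hi : i < L) :
    HasExpansion (nextBasis e M s J P a L N (q₀ * N)) (j * N + i + 2) 4
      (X * nextBasis e M s J P a L N (q₀ * N) (j * N + i)) := by
  have key : X * nextBasis e M s J P a L N (q₀ * N) (j * N + i) =
      (2 : 𝕜) • nextBasis e M s J P a L N (q₀ * N) (j * N + (i + 1)) := by
    rw [h.nextBasis_special hj hi.le, h.nextBasis_special hj hi, smul_smul, mul_smul_comm,
      ← mul_assoc, ← pow_succ']
    congr 1
    push_cast
    rw [pow_succ]
    ring
  rw [key]
  refine ((HasExpansion.self _ (show j * N + (i + 1) < _ by omega)).smul _).mono le_rfl ?_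
  rw [RCLike.norm_ofNat]
  norm_num

/-- Beyond the block only monomials are left, each costing at most `2 ^ s`; `L` was chosen so that
`a * 2 ^ (-L)` absorbs this. -/
theorem expansion_of_last (h : IsExtension e c M s J P a G q₀ L N K) {j : ℕ} (hj : j ∈ J) :
    HasExpansion (nextBasis e M s J P a L N (q₀ * N)) (j * N + L + 2) 4
      (X * nextBasis e M s J P a L N (q₀ * N) (j * N + L)) := by
  have hN := h.le_N
  have hjN := h.le_mul hj
  have hP := h.natDegree_lt j hj
  have hML := h.le_L
  have hcn := coeffNorm_nonneg (P j)
  have ha : 0 < a := zero_lt_one.trans_le h.one_le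
  set r : ℝ := a * (1 / 2) ^ L with hr
  have hr0 : 0 < r := h.special_pos L
  have hnot : ¬ ((j * N + L + 1) / N ∈ J ∧ (j * N + L + 1) % N ≤ L) := by
    rintro ⟨-, h2⟩
    rw [add_assoc, add_comm, Nat.add_mul_mod_self_right, Nat.mod_eq_of_lt (by omega)] at h2
    omega
  have hw : ∀ k, (dipWeight M s (q₀ * N) k)⁻¹ ≤ 2 ^ s := fun k => by
    have := le_dipWeight M s (q₀ * N) k
    rw [one_div, inv_pow] at this
    exact inv_le_of_inv_le₀ (by positivity) this
  have hr1 : r * (1 + coeffNorm (P j)) * 2 ^ s ≤ 1 := by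
    have := h.le_two_pow_L j hj
    have h2 : r = a / 2 ^ L := by rw [hr, one_div, inv_pow]; rfl
    rw [h2, div_mul_eq_mul_div, div_mul_eq_mul_div, div_le_one (by positivity)]
    exact this
  have hr2 : r * 2 ^ s ≤ 1 := le_trans (by
    have : 0 ≤ r * 2 ^ s := by positivity
    nlinarith [mul_nonneg this hcn]) hr1
  have hr3 : r * (coeffNorm (P j) * 2 ^ s) ≤ 1 := le_trans (by
    have : 0 ≤ r * 2 ^ s := by positivity
    nlinarith) hr1
  have key : X * nextBasis e M s J P a L N (q₀ * N) (j * N + L) =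
      (r : 𝕜) • X ^ (j * N + L + 1) + (-(r : 𝕜)) • (X ^ (L + 1) * P j) := by
    rw [h.nextBasis_special hj le_rfl, mul_smul_comm, neg_smul, ← smul_neg, ← smul_add]
    congr 1
    ring
  have hlow : HasExpansion (nextBasis e M s J P a L N (q₀ * N)) (j * N + L + 2)
      (coeffNorm (P j) * 2 ^ s) (X ^ (L + 1) * P j) := by
    rw [Polynomial.X_pow_mul_eq_sum_smul (L + 1) (Nat.lt_succ_self _), coeffNorm, Finset.sum_mul]
    refine HasExpansion.sum _ fun i hi => ?_
    have hi' := Finset.mem_range.1 hi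
    refine ((hasExpansion_X_pow (by omega) (fun hd => h.div_notMem (by omega) hd.1)
      (by omega)).smul _).mono le_rfl ?_
    exact mul_le_mul_of_nonneg_left (hw _) (norm_nonneg _)
  rw [key]
  refine (((hasExpansion_X_pow (by omega) hnot (by omega)).smul _).add (hlow.smul _)).mono
    le_rfl ?_
  rw [norm_neg, RCLike.norm_ofReal, abs_of_pos hr0]
  have := mul_le_mul_of_nonneg_left (hw (j * N + L + 1)) hr0.le
  linarith

/-- The delicate case is `k + 1 = j * N`, where `X ^ (k + 1)` is `P j` plus `a⁻¹` times a basis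
vector. The expansion of `P j` may be large, but the weight at `k` is already `2 ^ (-s)`. -/
theorem expansion_of_monomial (h : IsExtension e c M s J P a G q₀ L N K) {k : ℕ} (hk : M ≤ k)
    (hk' : ¬ (k / N ∈ J ∧ k % N ≤ L)) :
    HasExpansion (nextBasis e M s J P a L N (q₀ * N)) (k + 2) 4
      (X * nextBasis e M s J P a L N (q₀ * N) k) := by
  have hμ := dipWeight_pos M s (q₀ * N) k
  have hXk : X * nextBasis e M s J P a L N (q₀ * N) k =
      ((dipWeight M s (q₀ * N) k : ℝ) : 𝕜) • X ^ (k + 1) := by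
    rw [nextBasis_of_not hk hk', mul_smul_comm, ← pow_succ']
  rw [hXk]
  by_cases hs : (k + 1) / N ∈ J ∧ (k + 1) % N ≤ L
  · obtain ⟨j, hj, i, hi, hji⟩ : ∃ j ∈ J, ∃ i ≤ L, k + 1 = j * N + i :=
      ⟨_, hs.1, _, hs.2, (Nat.div_add_mod' (k + 1) N).symm⟩
    have hN := h.le_N
    have hjN := h.le_mul hj
    rcases i with _ | i
    · rw [add_zero] at hji
      have hkq : k < q₀ * N := by
        have := h.mul_add_lt hj h.N_pos
        omega
      have hw : dipWeight M s (q₀ * N) k = (1 / 2) ^ s := dipWeight_eq (by omega) hkq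
      obtain ⟨W, hW, hWs⟩ := h.exists_expansion j hj
      have ha : 0 < a := zero_lt_one.trans_le h.one_le
      have hXj : (X ^ (k + 1) : 𝕜[X]) =
          P j + ((a⁻¹ : ℝ) : 𝕜) • nextBasis e M s J P a L N (q₀ * N) (k + 1) := by
        have := h.nextBasis_special hj (Nat.zero_le L)
        rw [add_zero, pow_zero, pow_zero, mul_one, one_mul] at this
        rw [hji, this, smul_smul, ← RCLike.ofReal_mul, inv_mul_cancel₀ ha.ne',
          RCLike.ofReal_one, one_smul, add_sub_cancel]
      rw [hXj]
      have hW' : HasExpansion (nextBasis e M s J P a L N (q₀ * N)) (k + 2) W (P j) :=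
        (hW.congr fun m hm => h.nextBasis_of_le hm.le).mono (by omega) le_rfl
      refine ((hW'.add ((HasExpansion.self _ (Nat.lt_succ_self _)).smul _)).smul _).mono
        le_rfl ?_
      have h1 : a⁻¹ ≤ 1 := inv_le_one_of_one_le₀ h.one_le
      rw [RCLike.norm_ofReal, RCLike.norm_ofReal, abs_of_pos hμ, abs_of_pos (inv_pos.2 ha), mul_one,
        hw, one_div, inv_pow, inv_mul_le_iff₀ (by positivity)]
      have h2 : (1 : ℝ) ≤ 2 ^ s := one_le_pow₀ one_le_two
      linarith
    -- A block is entered only at offset `0`: if `k + 1` has offset `i + 1`, then `k` is itself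
    -- special.
    · exfalso
      have hk2 : k = j * N + i := by omega
      obtain ⟨h1, h2⟩ := h.div_mod (j := j) (i := i) (by omega)
      exact hk' ⟨by rwa [hk2, h1], by rw [hk2, h2]; omega⟩
  · refine ((hasExpansion_X_pow (by omega) hs (Nat.lt_succ_self _)).smul _).mono le_rfl ?_
    rw [RCLike.norm_ofReal, abs_of_pos hμ, mul_inv_le_iff₀ (dipWeight_pos _ _ _ _)]
    have := dipWeight_le_two_mul M s (q₀ * N) k
    have := dipWeight_pos M s (q₀ * N) (k + 1)
    linarith

theorem expansion (h : IsExtension e c M s J P a G q₀ L N K) (k : ℕ) :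
    HasExpansion (nextBasis e M s J P a L N (q₀ * N)) (k + 2) 4
      (X * nextBasis e M s J P a L N (q₀ * N) k) := by
  by_cases hk : k / N ∈ J ∧ k % N ≤ L
  · rw [← Nat.div_add_mod' k N]
    rcases hk.2.lt_or_eq with hL | hL
    · exact h.expansion_of_special hk.1 hL
    · rw [hL]
      exact h.expansion_of_last hk.1
  rcases lt_or_ge k M with hkM | hkM
  · rw [h.nextBasis_of_le hkM.le]
    exact (h.stage.expansion k).congr fun m hm => h.nextBasis_of_le (by omega)
  · exact h.expansion_of_monomial hkM hk

theorem moment_special_eq_zero (h : IsExtension e c M s J P a G q₀ L N K) {j : ℕ} (hj : j ∈ J)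
    {Q : 𝕜[X]} (hQ : Q.natDegree + M ≤ N) :
    moment (blockMoments c G N) ((X ^ (j * N) - P j) * Q) = 0 := by
  have hP := h.natDegree_lt j hj
  have h1 : (P j * Q).natDegree ≤ _ := natDegree_mul_le
  rw [sub_mul, map_sub, moment_blockMoments c G j (by omega),
    moment_blockMoments_of_lt c h.G_zero (by omega), h.G_mem j hj, mul_comm, sub_self]

/-- Since `G (i + j) = P i * P j`, the leading term cancels against `X ^ (i * N) * P j * Q`; the
rest is a single special difference with cofactor `P i * Q`. -/
theorem moment_special_special_eq_zero (h : IsExtension e c M s J P a G q₀ L N K) {i j : ℕ}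
    (hi : i ∈ J) (hj : j ∈ J) {Q : 𝕜[X]} (hQ : Q.natDegree + 2 * M ≤ N) :
    moment (blockMoments c G N) ((X ^ (i * N) - P i) * ((X ^ (j * N) - P j) * Q)) = 0 := by
  have hPi := h.natDegree_lt i hi
  have hPj := h.natDegree_lt j hj
  have h1 : (P i * Q).natDegree ≤ _ := natDegree_mul_le
  have h2 : (P j * Q).natDegree ≤ _ := natDegree_mul_le
  have key : (X ^ (i * N) - P i) * ((X ^ (j * N) - P j) * Q) =
      X ^ ((i + j) * N) * Q - X ^ (i * N) * (P j * Q) - (X ^ (j * N) - P j) * (P i * Q) := by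
    rw [add_mul, pow_add]; ring
  rw [key, map_sub, map_sub, h.moment_special_eq_zero hj (by omega),
    moment_blockMoments c G _ (by omega), moment_blockMoments c G _ (by omega),
    h.G_add i hi j hj, h.G_mem i hi, sub_zero]
  rw [show P j * Q * P i = Q * (P i * P j) by ring, sub_self]

theorem norm_moment_X_pow_mul_nextBasis_le (h : IsExtension e c M s J P a G q₀ L N K) (k l : ℕ) :
    ‖moment (blockMoments c G N) (X ^ k * nextBasis e M s J P a L N (q₀ * N) l)‖ ≤ 2 ^ s := by
  have hK : 0 ≤ K := (norm_nonneg _).trans (h.norm_le 0)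
  have hKs : K ≤ 2 ^ s := by
    have := h.coeffNorm_le M
    rwa [h.stage.eq_X_pow M le_rfl, coeffNorm_X_pow, mul_one] at this
  have hX : ∀ n, ‖moment (blockMoments c G N) (X ^ n)‖ ≤ 2 ^ s := fun n => by
    rw [moment_X_pow]; exact (h.norm_le n).trans hKs
  rcases h.nextBasis_cases l with ⟨-, r, hr0, hr1, hr⟩ | ⟨j, hj, i, hi, rfl⟩ | hl | ⟨-, hl⟩
  · rw [hr, mul_smul_comm, map_smul, norm_smul, RCLike.norm_ofReal, abs_of_nonneg hr0]
    exact (mul_le_of_le_one_left (norm_nonneg _) hr1).trans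
      ((norm_moment_X_pow_mul_le h.norm_le _ _).trans (h.coeffNorm_le l))
  · rw [h.nextBasis_special hj hi, mul_smul_comm, map_smul, norm_smul, RCLike.norm_ofReal,
      abs_of_pos (h.special_pos i),
      show X ^ k * (X ^ i * (X ^ (j * N) - P j)) =
        X ^ (k + i + j * N) - X ^ (k + i) * P j by ring, map_sub]
    refine (mul_le_mul (h.special_le_a i) ?_ (norm_nonneg _)
      (zero_le_one.trans h.one_le)).trans (h.special_le j hj)
    refine (norm_sub_le _ _).trans ?_
    rw [mul_add, mul_one, moment_X_pow]
    exact add_le_add (h.norm_le _) (norm_moment_X_pow_mul_le h.norm_le _ _)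
  · rw [hl, mul_smul_comm, map_smul, norm_smul, RCLike.norm_ofReal, ← pow_add,
      abs_of_pos (by positivity)]
    exact (mul_le_of_le_one_left (norm_nonneg _)
      (pow_le_one₀ (by norm_num) (by norm_num))).trans (hX _)
  · rw [hl, ← pow_add]
    exact hX _

theorem norm_moment_le_of_left_fresh (h : IsExtension e c M s J P a G q₀ L N K) {k : ℕ}
    (hk : nextBasis e M s J P a L N (q₀ * N) k = (((1 / 2) ^ s : ℝ) : 𝕜) • X ^ k ∨
      (q₀ * N ≤ k ∧ nextBasis e M s J P a L N (q₀ * N) k = X ^ k)) (l : ℕ) :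
    ‖moment (blockMoments c G N) (nextBasis e M s J P a L N (q₀ * N) k *
      nextBasis e M s J P a L N (q₀ * N) l)‖ ≤ 1 := by
  rcases hk with hk | ⟨hkq, hk⟩
  · rw [hk, smul_mul_assoc, map_smul, norm_smul, RCLike.norm_ofReal, abs_of_pos (by positivity),
      one_div, inv_pow, inv_mul_le_iff₀ (by positivity), mul_one]
    exact h.norm_moment_X_pow_mul_nextBasis_le k l
  · rw [hk, moment_X_pow_mul_eq_zero (fun k hk => h.blockMoments_of_large hk) hkq, norm_zero]
    exact zero_le_one

theorem moment_eq_zero_of_special_of_low (h : IsExtension e c M s J P a G q₀ L N K) {j i l : ℕ}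
    (hj : j ∈ J) (hi : i ≤ L) (hl : l < M + s) :
    moment (blockMoments c G N) (nextBasis e M s J P a L N (q₀ * N) (j * N + i) *
      nextBasis e M s J P a L N (q₀ * N) l) = 0 := by
  have hN := h.le_N
  have h1 : (X ^ i * nextBasis e M s J P a L N (q₀ * N) l).natDegree ≤ _ := natDegree_mul_le
  rw [natDegree_X_pow, natDegree_eq_of_degree_eq_some (h.nextBasis_degree l)] at h1
  rw [h.nextBasis_special hj hi, smul_mul_assoc, map_smul, mul_comm (X ^ i), mul_assoc,
    h.moment_special_eq_zero hj (by omega), smul_zero]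

/-- Low against low is the old bound; special against low or special gives zero; a monomial of
weight `2 ^ (-s)` compensates any pairing; from degree `q₀ * N` on, the moments vanish. -/
theorem bound (h : IsExtension e c M s J P a G q₀ L N K) (k l : ℕ) :
    ‖moment (blockMoments c G N) (nextBasis e M s J P a L N (q₀ * N) k *
      nextBasis e M s J P a L N (q₀ * N) l)‖ ≤ 1 := by
  have hN := h.le_N
  have hdeg : ∀ k, (e k).natDegree = k := fun k =>
    natDegree_eq_of_degree_eq_some (h.stage.degree_eq k)
  rcases h.nextBasis_cases k with ⟨hk, r, hr0, hr1, hr⟩ | ⟨j, hj, i, hi, rfl⟩ | hk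
  · rcases h.nextBasis_cases l with ⟨hl, t, ht0, ht1, ht⟩ | ⟨j, hj, i, hi, rfl⟩ | hl
    · have h1 : (e k * e l).natDegree ≤ _ := natDegree_mul_le
      rw [hdeg, hdeg] at h1
      rw [hr, ht, smul_mul_smul_comm, map_smul, norm_smul, ← RCLike.ofReal_mul,
        RCLike.norm_ofReal, abs_of_nonneg (mul_nonneg hr0 ht0),
        moment_blockMoments_of_lt c h.G_zero (by omega)]
      exact mul_le_one₀ (mul_le_one₀ hr1 ht0 ht1) (norm_nonneg _) (h.stage.bound k l)
    · rw [mul_comm, h.moment_eq_zero_of_special_of_low hj hi hk, norm_zero]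
      exact zero_le_one
    · rw [mul_comm]
      exact h.norm_moment_le_of_left_fresh hl k
  · rcases h.nextBasis_cases l with ⟨hl, -⟩ | ⟨j', hj', i', hi', rfl⟩ | hl
    · rw [h.moment_eq_zero_of_special_of_low hj hi hl, norm_zero]
      exact zero_le_one
    · rw [h.nextBasis_special hj hi, h.nextBasis_special hj' hi', smul_mul_smul_comm, map_smul,
        show X ^ i * (X ^ (j * N) - P j) * (X ^ i' * (X ^ (j' * N) - P j')) =
          (X ^ (j * N) - P j) * ((X ^ (j' * N) - P j') * X ^ (i + i')) by ring,
        h.moment_special_special_eq_zero hj hj' (by rw [natDegree_X_pow]; omega), smul_zero,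
        norm_zero]
      exact zero_le_one
    · rw [mul_comm]
      exact h.norm_moment_le_of_left_fresh hl _
  · exact h.norm_moment_le_of_left_fresh hk l

theorem isStage (h : IsExtension e c M s J P a G q₀ L N K) :
    IsStage (nextBasis e M s J P a L N (q₀ * N)) (blockMoments c G N) (q₀ * N) where
  degree_eq := h.nextBasis_degree
  eq_X_pow _ hk := h.nextBasis_of_large hk
  moment_eq_zero _ hk := h.blockMoments_of_large hk
  expansion := h.expansion
  bound := h.bound

end IsExtension

end Stage

/-! ### Choice of parameters and passage to the limit. -/

section Limit

variable {𝕜 : Type*} [RCLike 𝕜]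

theorem exists_upper_bound_lt (f : ℕ → ℝ) (m : ℕ) : ∃ B, 0 ≤ B ∧ ∀ k < m, f k ≤ B := by
  refine ⟨∑ k ∈ Finset.range m, |f k|, Finset.sum_nonneg fun _ _ => abs_nonneg _,
    fun k hk => (le_abs_self _).trans ?_⟩
  exact Finset.single_le_sum (f := fun k => |f k|) (fun _ _ => abs_nonneg _)
    (Finset.mem_range.2 hk)

theorem exists_upper_bound (f : ℕ → ℝ) {m : ℕ} {D : ℝ} (hf : ∀ k, m ≤ k → f k ≤ D) :
    ∃ B, 0 ≤ B ∧ ∀ k, f k ≤ B := by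
  obtain ⟨B, hB0, hB⟩ := exists_upper_bound_lt f m
  refine ⟨max B D, le_max_of_le_left hB0, fun k => ?_⟩
  rcases lt_or_ge k m with h | h
  · exact (hB k h).trans (le_max_left _ _)
  · exact (hf k h).trans (le_max_right _ _)

theorem exists_le_two_pow (B : ℝ) (m : ℕ) : ∃ n : ℕ, m ≤ n ∧ B ≤ 2 ^ n := by
  obtain ⟨n, hn⟩ := pow_unbounded_of_one_lt B one_lt_two
  exact ⟨max m n, le_max_left _ _,
    hn.le.trans (pow_le_pow_right₀ one_le_two (le_max_right _ _))⟩

/-- A stage extends to a later one in which the powers `X ^ (j * N)`, for `j` in the Sidon set `J`,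
are simultaneously close to prescribed polynomials. -/
theorem IsStage.exists_next {e : ℕ → 𝕜[X]} {c : ℕ → 𝕜} {M : ℕ} (hst : IsStage e c M)
    {J : Finset ℕ} (hJ0 : ∀ j ∈ J, 0 < j) (hJ : IsSidon ((J : Set ℕ) ∪ {0})) (P : ℕ → 𝕜[X])
    {a : ℝ} (ha : 1 ≤ a) :
    ∃ (e' : ℕ → 𝕜[X]) (c' : ℕ → 𝕜) (M' : ℕ), M < M' ∧ IsStage e' c' M' ∧
      (∀ k ≤ M, e' k = e k) ∧ (∀ k ≤ M, c' k = c k) ∧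
      ∃ N, ∀ j ∈ J, j * N < M' ∧ e' (j * N) = (a : 𝕜) • (X ^ (j * N) - P j) := by
  set M₁ := max M (J.sup fun j => (P j).natDegree + 1) with hM₁
  have hMM₁ : M ≤ M₁ := le_max_left _ _
  have hst₁ := hst.mono hMM₁
  have hPdeg : ∀ j ∈ J, (P j).natDegree < M₁ := fun j hj =>
    (Finset.le_sup (f := fun j => (P j).natDegree + 1) hj).trans (le_max_right _ _)
  obtain ⟨G, q₀, hG0, hGJ, hGadd, hGlarge, hq₀⟩ := exists_product_function_of_isSidon hJ hJ0 P
  have hq₀pos : 0 < q₀ := Nat.pos_of_ne_zero fun h0 => by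
    have := hGlarge 0 h0.le
    rw [hG0] at this
    exact one_ne_zero this
  obtain ⟨A, hA0, hA⟩ := exists_upper_bound (fun k => ‖c k‖) (m := M) (D := 0) fun k hk => by
    simp [hst.moment_eq_zero k hk]
  obtain ⟨A', hA'0, hA'⟩ := exists_upper_bound (fun q => coeffNorm (G q)) (m := q₀) (D := 0)
    fun q hq => by simp [hGlarge q hq, coeffNorm]
  obtain ⟨A'', hA''0, hA''⟩ := exists_upper_bound (fun l => coeffNorm (e l)) (m := M) (D := 1)
    fun l hl => by simp [hst.eq_X_pow l hl, coeffNorm_X_pow]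
  have hWex : ∀ j ∈ J, ∃ W, HasExpansion e M₁ W (P j) := fun j hj =>
    exists_hasExpansion hst.degree_eq (hPdeg j hj)
  choose! W hW using hWex
  obtain ⟨B₁, hB₁0, hB₁⟩ := exists_upper_bound_lt W q₀
  obtain ⟨B₂, hB₂0, hB₂⟩ := exists_upper_bound_lt
    (fun j => a * (A * A' * (1 + coeffNorm (P j)))) q₀
  -- No circularity: the bound `A * A'` on the new moments does not depend on `N`, so `s` comes
  -- first, then `L` from `s`, then `N` from both.
  obtain ⟨s, -, hs⟩ := exists_le_two_pow (A * A' * A'' + B₁ + B₂) 0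
  have hAA : 0 ≤ A * A' * A'' := by positivity
  obtain ⟨B₃, hB₃0, hB₃⟩ := exists_upper_bound_lt
    (fun j => a * (1 + coeffNorm (P j)) * 2 ^ s) q₀
  obtain ⟨L, hML, hL⟩ := exists_le_two_pow B₃ M₁
  obtain ⟨N, hN⟩ : ∃ N, N = 2 * (M₁ + s + L) + 2 := ⟨_, rfl⟩
  have hext : IsExtension e c M₁ s J P a G q₀ L N (A * A') :=
    { stage := hst₁
      pos := hJ0
      lt := hq₀
      q₀_pos := hq₀pos
      natDegree_lt := hPdeg
      G_zero := hG0
      G_mem := hGJ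
      G_add := hGadd
      G_large := hGlarge
      one_le := ha
      exists_expansion := fun j hj => ⟨W j, hW j hj, by linarith [hB₁ j (hq₀ j hj)]⟩
      le_two_pow_L := fun j hj => (hB₃ j (hq₀ j hj)).trans hL
      le_L := hML
      le_N := hN.ge
      norm_le := fun k => (norm_moment_X_pow_mul_le hA _ _).trans
        (mul_le_mul_of_nonneg_left (hA' _) hA0)
      coeffNorm_le := fun l => by
        have := mul_le_mul_of_nonneg_left (hA'' l) (mul_nonneg hA0 hA'0)
        linarith
      special_le := fun j hj => by linarith [hB₂ j (hq₀ j hj)] }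
  have hNle := hext.N_le
  refine ⟨_, _, q₀ * N, by omega, hext.isStage, fun k hk => hext.nextBasis_of_le (hk.trans hMM₁),
    fun k hk => hext.blockMoments_of_lt (by omega), N, fun j hj => ⟨?_, ?_⟩⟩
  · simpa using hext.mul_add_lt hj hext.N_pos
  · simpa using hext.nextBasis_special hj (Nat.zero_le L)

theorem isStage_X_pow : IsStage (fun k => (X ^ k : 𝕜[X])) (fun k => if k = 0 then 1 else 0) 1 where
  degree_eq k := degree_X_pow k
  eq_X_pow _ _ := rfl
  moment_eq_zero k hk := if_neg (by omega)
  expansion k := by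
    rw [← pow_succ']
    exact (HasExpansion.self (fun k => (X ^ k : 𝕜[X])) (Nat.lt_succ_self _)).mono le_rfl
      (by norm_num)
  bound k l := by
    rw [← pow_add, moment_X_pow]
    split_ifs <;> simp

/-- There is a basis of `𝕜[X]` and a functional with the required bounds for which countably many
approximation problems along Sidon sets are solved. -/
theorem exists_basis_of_tasks (J : ℕ → Finset ℕ) (hJ0 : ∀ n, ∀ j ∈ J n, 0 < j)
    (hJ : ∀ n, IsSidon ((J n : Set ℕ) ∪ {0})) (P : ℕ → ℕ → 𝕜[X]) (a : ℕ → ℝ)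
    (ha : ∀ n, 1 ≤ a n) :
    ∃ (e : ℕ → 𝕜[X]) (c : ℕ → 𝕜), (∀ k, (e k).degree = k) ∧ c 0 = 1 ∧
      (∀ k, HasExpansion e (k + 2) 4 (X * e k)) ∧ (∀ k l, ‖moment c (e k * e l)‖ ≤ 1) ∧
      ∀ n, ∃ N, ∀ j ∈ J n, e (j * N) = (a n : 𝕜) • (X ^ (j * N) - P n j) := by
  let σ := {p : (ℕ → 𝕜[X]) × (ℕ → 𝕜) × ℕ // IsStage p.1 p.2.1 p.2.2}
  have hstep : ∀ (n : ℕ) (p : σ), ∃ p' : σ, p.1.2.2 < p'.1.2.2 ∧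
      (∀ k ≤ p.1.2.2, p'.1.1 k = p.1.1 k) ∧ (∀ k ≤ p.1.2.2, p'.1.2.1 k = p.1.2.1 k) ∧
      ∃ N, ∀ j ∈ J n, j * N < p'.1.2.2 ∧
        p'.1.1 (j * N) = (a n : 𝕜) • (X ^ (j * N) - P n j) := by
    rintro n ⟨⟨e, c, M⟩, hp⟩
    obtain ⟨e', c', M', hM, hst, h1, h2, h3⟩ := hp.exists_next (hJ0 n) (hJ n) (P n) (ha n)
    exact ⟨⟨(e', c', M'), hst⟩, hM, h1, h2, h3⟩
  choose next hnextM hnexte hnextc hnextN using hstep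
  let S : ℕ → σ := fun n => Nat.rec ⟨(_, _, 1), isStage_X_pow⟩ next n
  let e : ℕ → ℕ → 𝕜[X] := fun n => (S n).1.1
  let c : ℕ → ℕ → 𝕜 := fun n => (S n).1.2.1
  let M : ℕ → ℕ := fun n => (S n).1.2.2
  have hS : ∀ n, IsStage (e n) (c n) (M n) := fun n => (S n).2
  have hM : StrictMono M := strictMono_nat_of_lt_succ fun n => hnextM n (S n)
  have hMn : ∀ n, n ≤ M n := hM.id_le
  have he : ∀ n m, n ≤ m → ∀ k ≤ M n, e m k = e n k := by
    intro n m hnm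
    induction m, hnm using Nat.le_induction with
    | base => exact fun k _ => rfl
    | succ m hnm ih =>
      exact fun k hk => (hnexte m (S m) k (hk.trans (hM.monotone hnm))).trans (ih k hk)
  have hc : ∀ n m, n ≤ m → ∀ k ≤ M n, c m k = c n k := by
    intro n m hnm
    induction m, hnm using Nat.le_induction with
    | base => exact fun k _ => rfl
    | succ m hnm ih =>
      exact fun k hk => (hnextc m (S m) k (hk.trans (hM.monotone hnm))).trans (ih k hk)
  -- Stages are frozen up to `M n ≥ n`, so the diagonal sequence agrees with stage `n` there.
  have he' : ∀ n k, k ≤ M n → e k k = e n k := fun n k hk => by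
    rcases le_total n k with h | h
    · exact he n k h k hk
    · exact (he k n h k (hMn k)).symm
  have hc' : ∀ n k, k ≤ M n → c k k = c n k := fun n k hk => by
    rcases le_total n k with h | h
    · exact hc n k h k hk
    · exact (hc k n h k (hMn k)).symm
  have hc0 : c 0 0 = 1 := by
    change (if (0 : ℕ) = 0 then (1 : 𝕜) else 0) = 1
    exact if_pos rfl
  refine ⟨fun k => e k k, fun k => c k k, fun k => (hS k).degree_eq k, hc0, fun k => ?_,
    fun k l => ?_, fun n => ?_⟩
  · have h1 := hMn (k + 1)
    change HasExpansion _ _ _ (X * e k k)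
    rw [he' (k + 1) k (by omega)]
    exact ((hS (k + 1)).expansion k).congr fun m hm => he' (k + 1) m (by omega)
  · have h1 := hMn (k + l)
    change ‖moment _ (e k k * e l l)‖ ≤ 1
    rw [he' (k + l) k (by omega), he' (k + l) l (by omega)]
    have hdeg : (e (k + l) k * e (k + l) l).natDegree < k + l + 1 := by
      refine Nat.lt_succ_of_le (natDegree_mul_le.trans_eq ?_)
      rw [natDegree_eq_of_degree_eq_some ((hS _).degree_eq k),
        natDegree_eq_of_degree_eq_some ((hS _).degree_eq l)]
    rw [moment_congr hdeg fun i hi => hc' (k + l) i (by omega)]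
    exact (hS (k + l)).bound k l
  · obtain ⟨N, hN⟩ := hnextN n (S n)
    refine ⟨N, fun j hj => ?_⟩
    obtain ⟨h1, h2⟩ := hN j hj
    exact (he' (n + 1) (j * N) h1.le).trans h2

/-- A countable family of polynomials, dense for every norm on `𝕜[X]`. -/
noncomputable def countablePoly (𝕜 : Type*) [RCLike 𝕜] : ((ℕ × ℕ) →₀ ℕ) →ₗ[ℕ] 𝕜[X] :=
  Finsupp.linearCombination ℕ fun p : ℕ × ℕ => monomial p.1 (TopologicalSpace.denseSeq 𝕜 p.2)

/-- The closure of an additive submonoid is again one, so it suffices to approximate monomials, by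
continuity in the coefficient. -/
theorem mem_closure_range_countablePoly {F : Type*} [NormedAddCommGroup F] [NormedSpace 𝕜 F]
    (ι : 𝕜[X] →ₗ[𝕜] F) (P : 𝕜[X]) :
    ι P ∈ closure (Set.range fun f => ι (countablePoly 𝕜 f)) := by
  let A : AddSubmonoid F :=
    AddMonoidHom.mrange (ι.toAddMonoidHom.comp (countablePoly 𝕜).toAddMonoidHom)
  change ι P ∈ A.topologicalClosure
  induction P using Polynomial.induction_on' with
  | add P Q hP hQ =>
    rw [map_add]
    exact add_mem hP hQ
  | monomial n b =>
    have hcont : Continuous fun b : 𝕜 => ι (monomial n b) := by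
      have : (fun b : 𝕜 => ι (monomial n b)) = fun b : 𝕜 => b • ι (monomial n 1) := by
        funext b
        rw [← map_smul, smul_monomial, smul_eq_mul, mul_one]
      rw [this]
      fun_prop
    refine (TopologicalSpace.denseRange_denseSeq 𝕜).induction_on
      (p := fun b => ι (monomial n b) ∈ A.topologicalClosure) b ?_ fun m => ?_
    · exact (AddSubmonoid.isClosed_topologicalClosure A).preimage hcont
    · refine A.le_topologicalClosure ⟨Finsupp.single (n, m) 1, ?_⟩
      simp [countablePoly]

end Limit

/-! ### The operator and the theorem. -/

theorem exists_operator_disjointHypercyclic_of_isSidon (𝕜 : Type*) [RCLike 𝕜] :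
    ∃ T : EllOne 𝕜 →L[𝕜] EllOne 𝕜, ¬ IsWeaklyMixing T ∧
      ∀ J : Finset ℕ, (∀ j ∈ J, 0 < j) → IsSidon ((J : Set ℕ) ∪ {0}) →
        IsDisjointHypercyclic (fun j : J => T ^ (j : ℕ)) := by
  -- A task is a finite Sidon set, a finitely supported family of targets and a precision; there are
  -- countably many.
  let τ := {J : Finset ℕ // (∀ j ∈ J, 0 < j) ∧ IsSidon ((J : Set ℕ) ∪ {0})} ×
    (ℕ →₀ ((ℕ × ℕ) →₀ ℕ)) × ℕ
  have : Nonempty τ := by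
    refine ⟨⟨∅, by simp, fun a ha b hb c hc d hd _ _ _ => ?_⟩, 0, 0⟩
    simp_all
  obtain ⟨t, ht⟩ := exists_surjective_nat τ
  obtain ⟨e, c, he, hc, hX, hφ, hN⟩ := exists_basis_of_tasks (𝕜 := 𝕜) (fun n => (t n).1.1)
    (fun n => (t n).1.2.1) (fun n => (t n).1.2.2) (fun n j => countablePoly 𝕜 ((t n).2.1 j))
    (fun n => (t n).2.2 + 1) (fun n => by simp)
  have hφ0 : moment c ≠ 0 := fun h0 => by
    have := moment_X_pow c 0
    rw [h0, hc] at this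
    exact zero_ne_one this
  obtain ⟨T, ι, hι, hιe, hT, hTw⟩ := exists_operator_of_basis e he (moment c) hφ0 hφ hX
  refine ⟨T, hTw, fun J hJ0 hJ => ⟨ι 1, fun U hU hUne => ?_⟩⟩
  have hdense : DenseRange fun f => ι (countablePoly 𝕜 f) := by
    intro x
    refine closure_minimal ?_ isClosed_closure (hι x)
    rintro _ ⟨P, rfl⟩
    exact mem_closure_range_countablePoly ι P
  choose f hf using fun j => hdense.exists_mem_open (hU j) (hUne j)
  choose ε hε hεU using fun j => Metric.isOpen_iff.1 (hU j) _ (hf j)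
  obtain ⟨m, hm⟩ : ∃ m : ℕ, ∀ j, 1 / ((m : ℝ) + 1) < ε j := by
    choose m hm using fun j => exists_nat_one_div_lt (hε j)
    refine ⟨Finset.univ.sup m, fun j => lt_of_le_of_lt ?_ (hm j)⟩
    have : m j ≤ Finset.univ.sup m := Finset.le_sup (Finset.mem_univ j)
    gcongr
  let g : ℕ →₀ ((ℕ × ℕ) →₀ ℕ) := Finsupp.onFinset J
    (fun j => if h : j ∈ J then f ⟨j, h⟩ else 0) fun j hj => by
      by_contra h
      exact hj (dif_neg h)
  obtain ⟨n, hn⟩ := ht (⟨J, hJ0, hJ⟩, g, m)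
  obtain ⟨N, hNn⟩ := hN n
  rw [hn] at hNn
  refine ⟨N, fun j => hεU j ?_⟩
  have key := hNn j j.2
  have hg : g j = f j := dif_pos j.2
  have hm0 : (0 : ℝ) < (m : ℝ) + 1 := by positivity
  -- The unit norm of `e (j * N)` says that `X ^ (j * N)` is at distance exactly `1 / (m + 1)` from
  -- its target.
  have hnorm := hιe (j * N)
  simp only at key
  rw [key, map_smul, norm_smul, RCLike.norm_ofReal, abs_of_pos hm0, hg] at hnorm
  rw [mem_ball_iff_norm, ← pow_mul, hT, mul_one, ← map_sub]
  refine lt_of_eq_of_lt ?_ (hm j)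
  rw [eq_div_iff hm0.ne', mul_comm]
  exact hnorm

theorem theorem3p2 (𝕜 : Type*) [RCLike 𝕜] :
    -- the characterization
    (∀ J : Finset ℕ, (∀ j ∈ J, 0 < j) →
      (IsSidon ((J : Set ℕ) ∪ {0}) ↔
        ∃ T : EllOne 𝕜 →L[𝕜] EllOne 𝕜,
          ¬ IsWeaklyMixing T ∧ IsDisjointHypercyclic (fun j : J => T ^ (j : ℕ)))) ∧
    -- one direction on every Banach space, for arbitrary sets of exponents
    (∀ (X : Type*) [NormedAddCommGroup X] [NormedSpace 𝕜 X] [CompleteSpace X]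
      (J : Set ℕ), (∀ j ∈ J, 0 < j) → ¬ IsSidon (J ∪ {0}) →
        ∀ T : X →L[𝕜] X, IsDisjointHypercyclic (fun j : J => T ^ (j : ℕ)) →
          IsWeaklyMixing T) ∧
    -- the other direction with a single operator for all finite sets of exponents
    (∃ T : EllOne 𝕜 →L[𝕜] EllOne 𝕜, ¬ IsWeaklyMixing T ∧
      ∀ J : Finset ℕ, (∀ j ∈ J, 0 < j) → IsSidon ((J : Set ℕ) ∪ {0}) →
        IsDisjointHypercyclic (fun j : J => T ^ (j : ℕ))) := by
  refine ⟨fun J hJ0 => ⟨fun hJ => ?_, ?_⟩, fun X _ _ _ J _ hJ T hT => hT.isWeaklyMixing hJ,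
    exists_operator_disjointHypercyclic_of_isSidon 𝕜⟩
  · obtain ⟨T, hT, hTJ⟩ := exists_operator_disjointHypercyclic_of_isSidon 𝕜
    exact ⟨T, hT, hTJ J hJ0 hJ⟩
  · rintro ⟨T, hT, hTJ⟩
    by_contra hJ
    exact hT (IsDisjointHypercyclic.isWeaklyMixing (J := (J : Set ℕ)) hJ hTJ)
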